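/- Let $n>1$ be an odd integer, let $F=\mathbb F_{2^n}$, regarded as a vector space over $\mathbb F_2$ with the nondegenerate symmetric bilinear form $(x,y)\mapsto \mathrm{Tr}(xy)$, where $\mathrm{Tr}\colon F\to\mathbb F_2$ is the absolute trace, and let $V=F\oplus F$. An operator $T\in\mathrm{End}_{\mathbb F_2}(F)$ is called skew-symmetric if $\mathrm{Tr}(x\,T(x))=0$ for all $x\in F$; for $a\in F$ let $E_{a,a}$ be the operator $x\mapsto\mathrm{Tr}(ax)a$. If $\Sigma\subseteq \mathrm{End}_{\mathbb F_2}(F)$ is a spread-set of self-adjoint operators, then its shadow $\Delta_\Sigma$ is the set of all skew-symmetric operators of the form $L+E_{a,a}$ with $L\in\Sigma$, $a\in F$ (each $L\in\Sigma$ has exactly one such $a$), and the dual hyperoval (DHO) in $V$ defined by the shadow is the set of subspaces $\mathbf D_\Sigma=\{\{(x,B(x)) : x\in F\} : B\in\Delta_\Sigma\}$. Two DHOs $\mathbf D,\mathbf D'$ in $V$ are isomorphic if some $T\in \mathrm{GL}(V)$ maps $\mathbf D$ onto $\mathbf D'$. For a chain $\mathbb F_2\subsetneq F_1\subsetneq\cdots\subsetneq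 F_m\subsetneq F$ of subfields ($m\ge 0$) and $a,b\in F$, let $E^{(i)}_{a,b}$ denote the operator $x\mapsto \mathrm{Tr}_{F/F_i}(ax)\,b$ on $F$, where $\mathrm{Tr}_{F/F_i}\colon F\to F_i$ is the trace. Consider the following two families of symplectic spread-sets $\Sigma=\{C(a): a\in F\}$. (1) (Semifield spread-sets.) Given such a chain and $c_1,\dots,c_m\in F\setminus\{0\}$, $$C(a)(x)=a^2x+\sum_{i=1}^m\bigl(E^{(i)}_{c_i,a}(x)+E^{(i)}_{a,c_i}(x)\bigr).$$ (2) (Nearly flag-transitive spread-sets.) Given such a chain and $c_1,\dots,c_m$ with $c_i\in F_i$ for all $i$, with $\sum_{i=1}^{j}c_i\ne 1$ for $1\le j\le m$, and with $c_j\ne0$ for at least one $j$, $$C(a)(x)=\Bigl(1+\sum_{i=1}^m c_i\Bigr)a^2x+\sum_{i=1}^m c_iE^{(i)}_{a,a}(x).$$ Theorem. No DHO $\mathbf D_\Sigma$ with $\Sigma$ from family (1) is isomorphic to a DHO $\mathbf D_{\Sigma'}$ with $\Sigma'$ from family (2) (the two chains of subfields and the two sequences of parameters being arbitrary and unrelated).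 -/

import Mathlib

namespace DualHyperoval

noncomputable section

section Shadow

variable {U : Type*} [AddCommGroup U] [Module (ZMod 2) U]

/-- The operator `E_{a,b} : x ↦ b(x,a) b` of rank at most one attached to a bilinear form. -/
def rankOne (β : LinearMap.BilinForm (ZMod 2) U) (a b : U) : Module.End (ZMod 2) U :=
  (LinearMap.toSpanSingleton (ZMod 2) U b) ∘ₗ (LinearMap.flip β a)

theorem rankOne_apply (β : LinearMap.BilinForm (ZMod 2) U) (a b x : U) :
    rankOne β a b x = β x a • b :=
  rfl

/-- In characteristic two, `T` is skew-symmetric with respect to `β` if `β(x, T x) = 0` for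
all `x` (by polarization this forces `T` to be self-adjoint when `β` is symmetric). -/
def IsSkew (β : LinearMap.BilinForm (ZMod 2) U) (T : Module.End (ZMod 2) U) : Prop :=
  ∀ x, β x (T x) = 0

/-- The shadow of a spread-set `S` of self-adjoint operators: every `L ∈ S` is replaced by the
skew-symmetric operator `L + E_{a,a}`, where `a` is the (unique) vector for which this operator
is skew-symmetric, that is, the label of `L` in the canonical labeling of `S`. -/
def shadow (β : LinearMap.BilinForm (ZMod 2) U) (S : Set (Module.End (ZMod 2) U)) :
    Set (Module.End (ZMod 2) U) :=
  {B | ∃ L ∈ S, ∃ a : U, B = L + rankOne β a a ∧ IsSkew β B}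

/-- If `C` is a canonical labeling, so that each `C a + E_{a,a}` is skew-symmetric, then the
shadow of its range is `{C a + E_{a,a} | a ∈ U}`. -/
theorem shadow_range (β : LinearMap.BilinForm (ZMod 2) U) (hβ : β.SeparatingRight)
    (C : U → Module.End (ZMod 2) U) (hC : ∀ a, IsSkew β (C a + rankOne β a a)) :
    shadow β (Set.range C) = Set.range fun a => C a + rankOne β a a := by
  ext B
  constructor
  · rintro ⟨_, ⟨a, rfl⟩, a', rfl, h⟩
    have hE : a' - a = 0 := by
      refine hβ _ fun x => ?_
      have h1 := h x
      have h2 := hC a x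
      simp only [LinearMap.add_apply, rankOne_apply, map_add, map_smul, smul_eq_mul] at h1 h2
      rw [map_sub]
      generalize β x (C a x) = r at h1 h2
      generalize β x a = s at h1 h2 ⊢
      generalize β x a' = t at h1 h2 ⊢
      revert r s t
      decide
    rw [sub_eq_zero] at hE
    exact ⟨a, by rw [hE]⟩
  · rintro ⟨a, rfl⟩
    exact ⟨C a, ⟨a, rfl⟩, a, rfl, hC a⟩

/-- The set of subspaces `V(L) = {(x, L x) | x ∈ U}` of `U ⊕ U`, for `L` in a set of
operators. -/
def graphs (S : Set (Module.End (ZMod 2) U)) : Set (Submodule (ZMod 2) (U × U)) :=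
  LinearMap.graph '' S

end Shadow

/-- Two sets of subspaces of a vector space over the field of two elements are isomorphic
(equivalent) if an invertible linear operator maps the first set onto the second. (The field of
two elements has no nontrivial automorphism, so semilinear operators are linear.) -/
def Isomorphic {V : Type*} [AddCommGroup V] [Module (ZMod 2) V]
    (D D' : Set (Submodule (ZMod 2) V)) : Prop :=
  ∃ T : V ≃ₗ[ZMod 2] V, (fun X => X.map (T : V →ₗ[ZMod 2] V)) '' D = D'

section Field

variable {F : Type*} [Field F] [Algebra (ZMod 2) F]

/-- A chain `𝔽₂ < K 0 < K 1 < ⋯ < K (m-1) < F` of `m` proper subfields of `F`, each of them larger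
than the prime field. -/
structure IsSubfieldChain {m : ℕ} (K : Fin m → IntermediateField (ZMod 2) F) : Prop where
  strictMono : StrictMono K
  bot_lt : ∀ i, ⊥ < K i
  lt_top : ∀ i, K i < ⊤

/-- The operator `x ↦ Tr_{F/K}(a x) b` on `F`, for a subfield `K` of `F`. -/
def traceOp (K : IntermediateField (ZMod 2) F) (a b : F) : Module.End (ZMod 2) F :=
  LinearMap.mulRight (ZMod 2) b ∘ₗ
    (Algebra.linearMap K F).restrictScalars (ZMod 2) ∘ₗ
      (Algebra.trace K F).restrictScalars (ZMod 2) ∘ₗ LinearMap.mulLeft (ZMod 2) a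

theorem traceOp_apply (K : IntermediateField (ZMod 2) F) (a b x : F) :
    traceOp K a b x = algebraMap K F (Algebra.trace K F (a * x)) * b :=
  rfl

/-- The operators `C(a) = a² 1 + ∑ᵢ (E⁽ⁱ⁾_{cᵢ,a} + E⁽ⁱ⁾_{a,cᵢ})`. -/
def semifieldOp {m : ℕ} (K : Fin m → IntermediateField (ZMod 2) F) (c : Fin m → F) (a : F) :
    Module.End (ZMod 2) F :=
  LinearMap.mulLeft (ZMod 2) (a ^ 2) + ∑ i, (traceOp (K i) (c i) a + traceOp (K i) a (c i))

/-- The operators `C(a) = (1 + ∑ᵢ cᵢ) a² 1 + ∑ᵢ cᵢ E⁽ⁱ⁾_{a,a}`. -/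
def nearFlagOp {m : ℕ} (K : Fin m → IntermediateField (ZMod 2) F) (c : Fin m → F) (a : F) :
    Module.End (ZMod 2) F :=
  LinearMap.mulLeft (ZMod 2) ((1 + ∑ i, c i) * a ^ 2) +
    ∑ i, LinearMap.mulLeft (ZMod 2) (c i) ∘ₗ traceOp (K i) a a

/-- The set of subspaces of `F ⊕ F` defined by the shadow of the semifield spread-set
`{C(a) | a ∈ F}`, with respect to the absolute trace form on `F`. -/
def semifieldDHO {m : ℕ} (K : Fin m → IntermediateField (ZMod 2) F) (c : Fin m → F) :
    Set (Submodule (ZMod 2) (F × F)) :=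
  graphs (shadow (Algebra.traceForm (ZMod 2) F) (Set.range (semifieldOp K c)))

/-- The set of subspaces of `F ⊕ F` defined by the shadow of the nearly flag-transitive
spread-set `{C(a) | a ∈ F}`, with respect to the absolute trace form on `F`. -/
def nearFlagDHO {m : ℕ} (K : Fin m → IntermediateField (ZMod 2) F) (c : Fin m → F) :
    Set (Submodule (ZMod 2) (F × F)) :=
  graphs (shadow (Algebra.traceForm (ZMod 2) F) (Set.range (nearFlagOp K c)))

end Field

end

end DualHyperoval

namespace DualHyperoval

/-! ### Bilinear and quadratic forms over the field of two elements. -/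

section Forms

variable {U : Type*} [AddCommGroup U] [Module (ZMod 2) U]

/-! Write B_a and B'_a for the members of the two shadows. The B'_a cover every singular vector of
the hyperbolic form Tr(xy) outside 0 ⊕ F, so an isomorphism T pulls that form back to one with the
same zeros there. Hence T is an isometry fixing 0 ⊕ F (`Isomorphic.exists_triangular`), and B'_a ∘ α
= M + δ ∘ B_{ρ(a)} with δ the inverse adjoint of α.

The semifield operators C(a) are additive in a, so the only nonlinearity of a ↦ B_a is E_{a,a}.
Transporting this along T gives a bijection s with s(0) = 0 such that s(d) = s(a) + s(b) implies
B'_a + B'_b + B'_d = E_{s(a),s(b)} + E_{s(b),s(a)} (`exists_bijective_of_isomorphic`).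

On the other side F^* acts by B'_{ua} = u B'_a u. Rank considerations make s commute with this
action, so s is multiplication by s(1) (`eq_mul_of_nearFlagSkew_add`). Thus s is additive, and a ↦
B'_a is quadratic with polarization of rank at most two. Its trace terms to the subfields K'_i then
have to cancel, and independence of traces along a chain (`eq_zero_of_sum_mul_subTrace_eq_mul`)
makes all c'_i zero, a contradiction. -/

theorem exists_ne_zero_forall_apply_eq_zero [FiniteDimensional (ZMod 2) U] {k : ℕ}
    (f : Fin k → Module.Dual (ZMod 2) U) (hk : k < Module.finrank (ZMod 2) U) :
    ∃ x ≠ 0, ∀ i, f i x = 0 := by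
  have h : LinearMap.ker (LinearMap.pi f) ≠ ⊥ :=
    LinearMap.ker_ne_bot_of_finrank_lt (by simpa using hk)
  obtain ⟨x, hx, hx0⟩ := Submodule.exists_mem_ne_zero_of_ne_bot h
  exact ⟨x, hx0, fun i => congrFun (LinearMap.mem_ker.mp hx) i⟩

theorem zmod_two_eq_one_of_ne_zero {r : ZMod 2} (h : r ≠ 0) : r = 1 := by
  revert r
  decide

/-- A bilinear form over the field of two elements whose zeros contain those of `β` is a
multiple of `β`. -/
theorem eq_smul_of_apply_eq_zero (β p : LinearMap.BilinForm (ZMod 2) U)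
    (h : ∀ x y, β x y = 0 → p x y = 0) : ∃ ε : ZMod 2, ∀ x y, p x y = ε * β x y := by
  by_cases hp : ∀ x y, p x y = 0
  · exact ⟨0, fun x y => by simp [hp x y]⟩
  push Not at hp
  obtain ⟨x₀, y₀, h₀⟩ := hp
  refine ⟨1, fun x y => ?_⟩
  -- By bilinearity everything depends on the values of both forms on {x, x₀} × {y, y₀}; these nine
  -- instances reduce the claim to a finite check.
  have h1 := h x₀ y₀
  have h2 := h x y
  have h3 := h x₀ y
  have h4 := h x y₀
  have h5 := h (x + x₀) y
  have h6 := h x (y + y₀)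
  have h7 := h x₀ (y + y₀)
  have h8 := h (x + x₀) y₀
  have h9 := h (x + x₀) (y + y₀)
  simp only [map_add, LinearMap.add_apply] at h5 h6 h7 h8 h9
  generalize p x y = a at *
  generalize p x₀ y = b at *
  generalize p x y₀ = c at *
  generalize p x₀ y₀ = d at *
  generalize β x y = a' at *
  generalize β x₀ y = b' at *
  generalize β x y₀ = c' at *
  generalize β x₀ y₀ = d' at *
  clear h β p
  have hz : ∀ r : ZMod 2, r = 0 ∨ r = 1 := by decide
  have h11 : (1 : ZMod 2) + 1 = 0 := by decide
  rcases hz a' with rfl | rfl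
  · rw [h2 rfl, mul_zero]
  obtain rfl := zmod_two_eq_one_of_ne_zero h₀
  obtain rfl := zmod_two_eq_one_of_ne_zero fun h => h₀ (h1 h)
  rcases hz b' with rfl | rfl <;> rcases hz c' with rfl | rfl <;>
    rcases hz a with rfl | rfl <;> rcases hz b with rfl | rfl <;> rcases hz c with rfl | rfl <;>
      simp_all

/-- If a quadratic form on `U ⊕ U` vanishes at every `(x, y)` with `x ≠ 0` and `β x y = 0`,
then it is a multiple of the hyperbolic form `(x, y) ↦ β x y`. -/
theorem quadratic_eq_smul_hyperbolic [FiniteDimensional (ZMod 2) U]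
    (hdim : 3 ≤ Module.finrank (ZMod 2) U) (β : LinearMap.BilinForm (ZMod 2) U)
    (hβ : ∀ x, (∀ y, β x y = 0) → x = 0) (A : LinearMap.BilinForm (ZMod 2) (U × U))
    (hA : ∀ x y, x ≠ 0 → β x y = 0 → A (x, y) (x, y) = 0) :
    ∃ ε : ZMod 2, ∀ x y, A (x, y) (x, y) = ε * β x y := by
  let ι₁ := LinearMap.inl (ZMod 2) U U
  let ι₂ := LinearMap.inr (ZMod 2) U U
  obtain ⟨p, hp⟩ : ∃ p : LinearMap.BilinForm (ZMod 2) U,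
      ∀ x y, p x y = A (x, 0) (0, y) + A (0, y) (x, 0) :=
    ⟨A.compl₁₂ ι₁ ι₂ + A.flip.compl₁₂ ι₁ ι₂, fun x y => rfl⟩
  have hx0 : ∀ x, A (x, 0) (x, 0) = 0 := fun x => by
    by_cases hx : x = 0
    · subst hx
      exact map_zero _
    · exact hA x 0 hx (map_zero _)
  have hexp : ∀ x y, A (x, y) (x, y) = p x y + A (0, y) (0, y) := fun x y => by
    have h1 : ((x, y) : U × U) = (x, 0) + (0, y) := by simp
    rw [h1, LinearMap.map_add₂, map_add, map_add, hx0, hp]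
    ring
  have hr : ∀ y, A (0, y) (0, y) = 0 := fun y => by
    -- Find x₁, x₂ and x₁ + x₂ all nonzero and orthogonal to y; u separates x₁ from x₂. As p is
    -- additive in x, adding the three instances leaves A (0, y) (0, y) = 0.
    obtain ⟨x₁, hx₁, h₁⟩ := exists_ne_zero_forall_apply_eq_zero ![β.flip y] (by omega)
    obtain ⟨u, hu⟩ := not_forall.mp fun h => hx₁ (hβ x₁ h)
    obtain ⟨x₂, hx₂, h₂⟩ := exists_ne_zero_forall_apply_eq_zero ![β.flip y, β.flip u] (by omega)
    have h11 : β x₁ y = 0 := h₁ 0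
    have h20 : β x₂ y = 0 := h₂ 0
    have h21 : β x₂ u = 0 := h₂ 1
    have h3 : x₁ + x₂ ≠ 0 := fun h => hu (by
      have := congrArg (fun z => β z u) h
      simpa [h21] using this)
    have e1 := hA x₁ y hx₁ h11
    have e2 := hA x₂ y hx₂ h20
    have e3 := hA (x₁ + x₂) y h3 (by simp [h11, h20])
    rw [hexp] at e1 e2 e3
    rw [map_add, LinearMap.add_apply] at e3
    generalize p x₁ y = a at *
    generalize p x₂ y = b at *
    generalize A (0, y) (0, y) = c at *
    clear * - e1 e2 e3
    revert a b c
    decide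
  obtain ⟨ε, hε⟩ := eq_smul_of_apply_eq_zero β p fun x y hxy => by
    by_cases hx : x = 0
    · simp [hx]
    · have := hA x y hx hxy
      rwa [hexp, hr, add_zero] at this
  exact ⟨ε, fun x y => by rw [hexp, hr, add_zero, hε]⟩

/-- Let `S` and `S'` be sets of operators on `U` with isomorphic sets of graphs. If the
operators in `S` and `S'` are skew-symmetric, and if the graphs of the operators in `S'` cover
every vector `(x, y)` with `x ≠ 0` and `β x y = 0`, then the isomorphism is an isometry of the
hyperbolic form that leaves `0 ⊕ U` invariant. -/
theorem Isomorphic.exists_triangular [FiniteDimensional (ZMod 2) U]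
    (hdim : 3 ≤ Module.finrank (ZMod 2) U) (β : LinearMap.BilinForm (ZMod 2) U)
    (hβ : ∀ x, (∀ y, β x y = 0) → x = 0) {S S' : Set (Module.End (ZMod 2) U)}
    (hS : ∀ B ∈ S, IsSkew β B)
    (hS' : ∀ x y, x ≠ 0 → β x y = 0 → ∃ B ∈ S', B x = y)
    (hiso : Isomorphic (graphs S) (graphs S')) :
    ∃ α δ M : Module.End (ZMod 2) U, Function.Surjective α ∧ Function.Injective δ ∧
      (∀ x y, β (α x) (δ y) = β x y) ∧
      ∀ B' ∈ S', ∃ B ∈ S, ∀ x, B' (α x) = M x + δ (B x) := by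
  obtain ⟨T, hT⟩ := hiso
  have hpre : ∀ B' ∈ S', ∃ B ∈ S,
      B.graph.map (T : U × U →ₗ[ZMod 2] U × U) = LinearMap.graph B' := fun B' hB' => by
    have h : LinearMap.graph B' ∈ graphs S' := ⟨B', hB', rfl⟩
    rw [← hT] at h
    obtain ⟨_, ⟨B, hB, rfl⟩, h⟩ := h
    exact ⟨B, hB, h⟩
  let ψ : U × U →ₗ[ZMod 2] U × U := T.symm
  let A : LinearMap.BilinForm (ZMod 2) (U × U) :=
    β.compl₁₂ (LinearMap.fst (ZMod 2) U U ∘ₗ ψ) (LinearMap.snd (ZMod 2) U U ∘ₗ ψ)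
  have hA : ∀ v, A v v = β (T.symm v).1 (T.symm v).2 := fun v => rfl
  have hcov : ∀ x y, x ≠ 0 → β x y = 0 → ∃ B ∈ S, B (T.symm (x, y)).1 = (T.symm (x, y)).2 := by
    intro x y hx hxy
    obtain ⟨B', hB', h⟩ := hS' x y hx hxy
    obtain ⟨B, hB, hBB'⟩ := hpre B' hB'
    have hmem : (x, y) ∈ LinearMap.graph B' := h.symm
    rw [← hBB'] at hmem
    obtain ⟨v, hv, hv'⟩ := hmem
    have hv'' : T.symm (x, y) = v := by
      rw [← hv']
      exact T.symm_apply_apply v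
    exact ⟨B, hB, by rw [hv'']; exact hv.symm⟩
  obtain ⟨ε, hε⟩ := quadratic_eq_smul_hyperbolic hdim β hβ A fun x y hx hxy => by
    obtain ⟨B, hB, h⟩ := hcov x y hx hxy
    rw [hA, ← h]
    exact hS B hB _
  have hε1 : ε = 1 := by
    apply zmod_two_eq_one_of_ne_zero
    rintro rfl
    obtain ⟨x, hx, -⟩ := exists_ne_zero_forall_apply_eq_zero (U := U) ![] (by omega)
    refine hx (hβ x fun y => ?_)
    have := hε (T (x, y)).1 (T (x, y)).2
    rw [hA, zero_mul] at this
    simpa using this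
  subst hε1
  have hiso : ∀ v, β (T v).1 (T v).2 = β v.1 v.2 := fun v => by
    have := hε (T v).1 (T v).2
    rw [hA, one_mul] at this
    simpa using this.symm
  -- Otherwise T (0, y) is singular and covered, so (0, y) lies on the graph of some B, which forces
  -- y = B 0 = 0.
  have hY : ∀ y, (T (0, y)).1 = 0 := fun y => by
    by_contra h
    obtain ⟨B, -, hB⟩ := hcov (T (0, y)).1 (T (0, y)).2 h (by rw [hiso]; simp)
    simp only [Prod.mk.eta, LinearEquiv.symm_apply_apply, map_zero] at hB
    rw [← hB] at h
    exact h (by rw [← Prod.zero_eq_mk, map_zero]; rfl)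
  let τ : U × U →ₗ[ZMod 2] U × U := T
  let α : Module.End (ZMod 2) U := LinearMap.fst _ U U ∘ₗ τ ∘ₗ LinearMap.inl _ U U
  let M : Module.End (ZMod 2) U := LinearMap.snd _ U U ∘ₗ τ ∘ₗ LinearMap.inl _ U U
  let δ : Module.End (ZMod 2) U := LinearMap.snd _ U U ∘ₗ τ ∘ₗ LinearMap.inr _ U U
  have hT1 : ∀ x y, T (x, y) = (α x, M x + δ y) := fun x y => by
    have h1 : ((x, y) : U × U) = (x, 0) + (0, y) := by simp
    have h2 : T (0, y) = (0, δ y) := Prod.ext (hY y) rfl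
    have h3 : T (x, 0) = (α x, M x) := rfl
    rw [h1, map_add, h2, h3, Prod.mk_add_mk, add_zero]
  refine ⟨α, δ, M, fun x => ?_, fun y y' h => ?_, fun x y => ?_, fun B' hB' => ?_⟩
  · refine ⟨(T.symm (x, 0)).1, ?_⟩
    have := hT1 (T.symm (x, 0)).1 (T.symm (x, 0)).2
    rw [Prod.mk.eta, T.apply_symm_apply] at this
    exact (congrArg Prod.fst this).symm
  · have h1 : T (0, y) = T (0, y') := by rw [hT1, hT1, h]
    exact congrArg Prod.snd (T.injective h1)
  · have h1 := hiso (x, y)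
    have h2 := hiso (x, 0)
    rw [hT1] at h1 h2
    simp only [map_add, map_zero, add_zero] at h1 h2
    rwa [h2, zero_add] at h1
  · obtain ⟨B, hB, hBB'⟩ := hpre B' hB'
    refine ⟨B, hB, fun x => ?_⟩
    have : T (x, B x) ∈ LinearMap.graph B' := by
      rw [← hBB']
      exact ⟨(x, B x), rfl, rfl⟩
    rw [hT1] at this
    exact this.symm

/-- A map `g` of a nondegenerate space onto itself that preserves the operators
`E_{p,q} + E_{q,p}` is the identity. -/
theorem eq_self_of_rankOne_add_rankOne [FiniteDimensional (ZMod 2) U]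
    (hdim : 3 ≤ Module.finrank (ZMod 2) U) (β : LinearMap.BilinForm (ZMod 2) U)
    (hβ : ∀ x, (∀ y, β y x = 0) → x = 0) (g : U → U) (hg : Function.Surjective g)
    (h : ∀ p q, rankOne β p q + rankOne β q p = rankOne β (g p) (g q) + rankOne β (g q) (g p))
    (p : U) : g p = p := by
  by_contra hne
  -- If there is no such x, then g p is 0 or p; the value 0 would make every E_{p,q} + E_{q,p}
  -- vanish. Given x, evaluating at x puts all of g's image in the span of p and g p, too small for
  -- a surjection.
  obtain ⟨x, hx, hx'⟩ : ∃ x, β x p = 0 ∧ β x (g p) = 1 := by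
    by_contra! hcon
    have hcon' : ∀ x, β x p = 0 → β x (g p) = 0 := fun x hx => by
      by_contra h0
      exact hcon x hx (zmod_two_eq_one_of_ne_zero h0)
    by_cases hp : p = 0
    · subst hp
      exact hne (hβ _ fun x => hcon' x (map_zero _))
    obtain ⟨x₀, hx₀⟩ := not_forall.mp fun h => hp (hβ p h)
    have hx₀ := zmod_two_eq_one_of_ne_zero hx₀
    have key : ∀ x, β x (g p) = β x p * β x₀ (g p) := fun x => by
      have := hcon' (x - β x p • x₀) (by simp [hx₀])
      simp only [map_sub, map_smul, LinearMap.sub_apply, LinearMap.smul_apply, smul_eq_mul] at this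
      exact sub_eq_zero.mp this
    by_cases h1 : β x₀ (g p) = 0
    · have hgp : g p = 0 := hβ _ fun x => by rw [key, h1, mul_zero]
      obtain ⟨q, hq, hq'⟩ := exists_ne_zero_forall_apply_eq_zero ![β x₀] (by omega)
      have hq0 : β x₀ q = 0 := hq' 0
      have := LinearMap.congr_fun (h p q) x₀
      simp [rankOne_apply, hgp, hx₀, hq0] at this
      exact hq this
    · refine hne (sub_eq_zero.mp (hβ _ fun x => ?_))
      rw [map_sub, key, zmod_two_eq_one_of_ne_zero h1, mul_one, sub_self]
  have key : ∀ q, β x q • p = g q + β x (g q) • g p := fun q => by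
    have := LinearMap.congr_fun (h p q) x
    simpa [rankOne_apply, hx, hx'] using this
  obtain ⟨f, hf⟩ : ∃ f : U → ZMod 2 × ZMod 2, ∀ q, g q = (f q).1 • p + (f q).2 • g p :=
    ⟨fun q => (β x q, β x (g q)), fun q => by
      rw [key, add_assoc, ZModModule.add_self, add_zero]⟩
  have hle : Module.finrank (ZMod 2) U ≤ 2 := by
    have : (⊤ : Submodule (ZMod 2) U) ≤ Submodule.span (ZMod 2) {p, g p} := fun v _ => by
      obtain ⟨q, rfl⟩ := hg v
      exact Submodule.mem_span_pair.mpr ⟨_, _, (hf q).symm⟩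
    calc Module.finrank (ZMod 2) U = Module.finrank (ZMod 2) (⊤ : Submodule (ZMod 2) U) :=
          (finrank_top (ZMod 2) U).symm
      _ ≤ Module.finrank (ZMod 2) (Submodule.span (ZMod 2) {p, g p}) :=
          Submodule.finrank_mono this
      _ ≤ 2 := by
          classical
          have := finrank_span_finset_le_card (R := ZMod 2) ({p, g p} : Finset U)
          rw [Finset.coe_pair] at this
          exact this.trans Finset.card_le_two
  omega

end Forms

/-! ### Relative traces as maps of F into itself. -/

section RelativeTrace

variable {k L F : Type*} [Field k] [Field L] [Field F] [Algebra k F] [Algebra L F]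

variable (k) in
/-- The trace to the subfield `k` of `F`, as an element of `F`. -/
noncomputable def subTrace (x : F) : F :=
  algebraMap k F (Algebra.trace k F x)

theorem subTrace_add (x y : F) : subTrace k (x + y) = subTrace k x + subTrace k y := by
  simp [subTrace]

theorem subTrace_zero : subTrace k (0 : F) = 0 := by
  simp [subTrace]

theorem subTrace_sum {ι : Type*} (s : Finset ι) (f : ι → F) :
    subTrace k (∑ i ∈ s, f i) = ∑ i ∈ s, subTrace k (f i) := by
  simp [subTrace]

theorem subTrace_algebraMap_mul (r : k) (x : F) :
    subTrace k (algebraMap k F r * x) = algebraMap k F r * subTrace k x := by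
  rw [subTrace, ← Algebra.smul_def, map_smul, smul_eq_mul, map_mul, subTrace]

theorem subTrace_subTrace_mul (x y : F) :
    subTrace k (subTrace k x * y) = subTrace k x * subTrace k y :=
  subTrace_algebraMap_mul _ _

variable [CharP F 2]

theorem natCast_eq_one_of_odd {n : ℕ} (hn : Odd n) : (n : F) = 1 := by
  obtain ⟨j, rfl⟩ := hn
  push_cast
  rw [CharTwo.two_eq_zero, zero_mul, zero_add]

theorem subTrace_algebraMap (h : Odd (Module.finrank k F)) (r : k) :
    subTrace k (algebraMap k F r) = algebraMap k F r := by
  rw [subTrace, Algebra.trace_algebraMap, map_nsmul, nsmul_eq_mul, natCast_eq_one_of_odd h,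
    one_mul]

/-- Taking the trace from F to L of an element of L multiplies it by the degree, which is 1 in
characteristic two when odd. -/
theorem subTrace_subTrace_of_tower [Algebra k L] [IsScalarTower k L F] [FiniteDimensional k F]
    (h : Odd (Module.finrank L F)) (x : F) : subTrace k (subTrace L x) = subTrace k x := by
  have := FiniteDimensional.left k L F
  have := FiniteDimensional.right k L F
  rw [subTrace, ← Algebra.trace_trace (S := L), subTrace, Algebra.trace_algebraMap, map_nsmul,
    map_nsmul, nsmul_eq_mul, natCast_eq_one_of_odd h, one_mul, Algebra.trace_trace, subTrace]

theorem subTrace_sq [FiniteDimensional k F] [IsGalois k F] (x : F) :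
    subTrace k (x ^ 2) = subTrace k x ^ 2 := by
  rw [subTrace, subTrace, trace_eq_sum_automorphisms, trace_eq_sum_automorphisms,
    CharTwo.sum_sq]
  simp

end RelativeTrace

/-! ### Traces to intermediate fields in odd degree. -/

section Subfields

variable {F : Type*} [Field F] [Algebra (ZMod 2) F]

theorem charP_two_of_algebra : CharP F 2 :=
  charP_of_injective_algebraMap (algebraMap (ZMod 2) F).injective 2

section SubTrace

variable (K : IntermediateField (ZMod 2) F)

theorem subTrace_mem (x : F) : subTrace K x ∈ K :=
  (Algebra.trace K F x).2

variable {K}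

theorem subTrace_mul_of_mem {r : F} (hr : r ∈ K) (x : F) :
    subTrace K (r * x) = r * subTrace K x :=
  subTrace_algebraMap_mul (⟨r, hr⟩ : K) x

variable (K)

theorem odd_finrank_right (h : Odd (Module.finrank (ZMod 2) F)) : Odd (Module.finrank K F) := by
  rw [← Module.finrank_mul_finrank (ZMod 2) K F] at h
  exact (Nat.odd_mul.mp h).2

theorem odd_finrank_left (h : Odd (Module.finrank (ZMod 2) F)) :
    Odd (Module.finrank (ZMod 2) K) := by
  rw [← Module.finrank_mul_finrank (ZMod 2) K F] at h
  exact (Nat.odd_mul.mp h).1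

variable {K}

theorem subTrace_of_mem [CharP F 2] (h : Odd (Module.finrank (ZMod 2) F)) {r : F} (hr : r ∈ K) :
    subTrace K r = r :=
  subTrace_algebraMap (odd_finrank_right K h) (⟨r, hr⟩ : K)

theorem subTrace_subTrace_of_le [CharP F 2] [Finite F] (h : Odd (Module.finrank (ZMod 2) F))
    {L : IntermediateField (ZMod 2) F} (hKL : K ≤ L) (x : F) :
    subTrace K (subTrace L x) = subTrace K x := by
  let _ : Algebra K L := (IntermediateField.inclusion hKL).toAlgebra
  have : IsScalarTower K L F := IsScalarTower.of_algebraMap_eq fun _ => rfl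
  exact subTrace_subTrace_of_tower (odd_finrank_right L h) x

variable (K)

theorem subTrace_zmod_subTrace [CharP F 2] [Finite F] (h : Odd (Module.finrank (ZMod 2) F))
    (x : F) : subTrace (ZMod 2) (subTrace K x) = subTrace (ZMod 2) x :=
  subTrace_subTrace_of_tower (odd_finrank_right K h) x

theorem subTrace_zmod_subTrace_mul [CharP F 2] [Finite F]
    (h : Odd (Module.finrank (ZMod 2) F)) (x y : F) :
    subTrace (ZMod 2) (subTrace K x * y) = subTrace (ZMod 2) (subTrace K x * subTrace K y) := by
  rw [← subTrace_subTrace_mul, subTrace_zmod_subTrace K h]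

variable {K}

/-- If d ≠ 0, then rd = s lies in K, so the trace to K fixes it; but that trace is r times the trace
of d, which is 0. -/
theorem eq_zero_of_mul_sq_eq_mul [CharP F 2] (h : Odd (Module.finrank (ZMod 2) F)) {r s d : F}
    (hr : r ∈ K) (hr0 : r ≠ 0) (hs : s ∈ K) (hd : subTrace K d = 0) (hrs : r * d ^ 2 = s * d) :
    d = 0 := by
  by_contra hd0
  have h1 : r * d = s := mul_right_cancel₀ hd0 (by rw [← hrs]; ring)
  have h2 : s = 0 := by
    rw [← subTrace_of_mem h hs, ← h1, subTrace_mul_of_mem hr, hd, mul_zero]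
  rw [h2] at h1
  exact (mul_ne_zero hr0 hd0) h1

end SubTrace

theorem subTrace_zmod_eq_zero_iff {x : F} :
    subTrace (ZMod 2) x = 0 ↔ Algebra.trace (ZMod 2) F x = 0 :=
  map_eq_zero_iff _ (algebraMap (ZMod 2) F).injective

theorem rankOne_traceForm_apply (a b x : F) :
    rankOne (Algebra.traceForm (ZMod 2) F) a b x = subTrace (ZMod 2) (x * a) * b := by
  rw [rankOne_apply, Algebra.smul_def, Algebra.traceForm_apply, subTrace]

theorem traceForm_separating [Finite F] (x : F)
    (h : ∀ y, Algebra.traceForm (ZMod 2) F x y = 0) : x = 0 :=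
  (traceForm_nondegenerate (ZMod 2) F).1 x h

theorem traceForm_separating_right [Finite F] (x : F)
    (h : ∀ y, Algebra.traceForm (ZMod 2) F y x = 0) : x = 0 :=
  (traceForm_nondegenerate (ZMod 2) F).2 x h

theorem isSkew_traceForm_iff {B : Module.End (ZMod 2) F} :
    IsSkew (Algebra.traceForm (ZMod 2) F) B ↔ ∀ x, subTrace (ZMod 2) (x * B x) = 0 :=
  forall_congr' fun _ => subTrace_zmod_eq_zero_iff.symm

/-! ### The two families of shadows: skew-symmetry, spread property, symmetry. -/

section Families

variable {m : ℕ} (K : Fin m → IntermediateField (ZMod 2) F) (c : Fin m → F)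

theorem semifieldOp_apply (a x : F) : semifieldOp K c a x =
    a ^ 2 * x + ∑ i, (subTrace (K i) (c i * x) * a + subTrace (K i) (a * x) * c i) := by
  simp only [semifieldOp, LinearMap.add_apply, LinearMap.sum_apply, traceOp_apply,
    LinearMap.mulLeft_apply]
  rfl

theorem nearFlagOp_apply (a x : F) : nearFlagOp K c a x =
    (1 + ∑ i, c i) * a ^ 2 * x + ∑ i, c i * (subTrace (K i) (a * x) * a) := by
  simp only [nearFlagOp, LinearMap.add_apply, LinearMap.sum_apply, LinearMap.comp_apply,
    traceOp_apply, LinearMap.mulLeft_apply]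
  rfl

/-- The members of the shadow of the semifield spread-set. -/
noncomputable def semifieldSkew (a : F) : Module.End (ZMod 2) F :=
  semifieldOp K c a + rankOne (Algebra.traceForm (ZMod 2) F) a a

/-- The members of the shadow of the nearly flag-transitive spread-set. -/
noncomputable def nearFlagSkew (a : F) : Module.End (ZMod 2) F :=
  nearFlagOp K c a + rankOne (Algebra.traceForm (ZMod 2) F) a a

theorem semifieldSkew_apply (a x : F) : semifieldSkew K c a x =
    a ^ 2 * x + ∑ i, (subTrace (K i) (c i * x) * a + subTrace (K i) (a * x) * c i) +
      subTrace (ZMod 2) (x * a) * a := by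
  rw [semifieldSkew, LinearMap.add_apply, semifieldOp_apply, rankOne_traceForm_apply]

theorem nearFlagSkew_apply (a x : F) : nearFlagSkew K c a x =
    (1 + ∑ i, c i) * a ^ 2 * x + ∑ i, c i * (subTrace (K i) (a * x) * a) +
      subTrace (ZMod 2) (x * a) * a := by
  rw [nearFlagSkew, LinearMap.add_apply, nearFlagOp_apply, rankOne_traceForm_apply]


/-- Since a ↦ a² is additive in characteristic two, the semifield operators are additive in a and
cancel; only the rank-one terms survive. -/
theorem semifieldSkew_add_add_add_add [CharP F 2] (a b d : F) :
    semifieldSkew K c a + semifieldSkew K c b + semifieldSkew K c d +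
        semifieldSkew K c (a + b + d) =
      rankOne (Algebra.traceForm (ZMod 2) F) (a + d) (b + d) +
        rankOne (Algebra.traceForm (ZMod 2) F) (b + d) (a + d) := by
  ext x
  have h2 : (2 : F) = 0 := CharTwo.two_eq_zero
  simp only [LinearMap.add_apply, semifieldSkew_apply, rankOne_traceForm_apply, add_mul, mul_add,
    subTrace_add, Finset.sum_add_distrib]
  simp only [CharTwo.add_sq]
  grind

theorem isSkew_semifieldSkew [CharP F 2] [Finite F]
    (h : Odd (Module.finrank (ZMod 2) F)) (a : F) :
    IsSkew (Algebra.traceForm (ZMod 2) F) (semifieldSkew K c a) := by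
  rw [isSkew_traceForm_iff]
  intro x
  have h1 : ∀ i, subTrace (ZMod 2)
      (x * (subTrace (K i) (c i * x) * a + subTrace (K i) (a * x) * c i)) = 0 := fun i => by
    have e : x * (subTrace (K i) (c i * x) * a + subTrace (K i) (a * x) * c i) =
      subTrace (K i) (c i * x) * (a * x) + subTrace (K i) (a * x) * (c i * x) := by ring
    rw [e, subTrace_add, subTrace_zmod_subTrace_mul _ h (c i * x) (a * x),
      subTrace_zmod_subTrace_mul _ h (a * x) (c i * x),
      mul_comm (subTrace (K i) (c i * x)), CharTwo.add_self_eq_zero]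
  have e1 : x * (a ^ 2 * x) = (x * a) ^ 2 := by ring
  have e2 : x * (subTrace (ZMod 2) (x * a) * a) = subTrace (ZMod 2) (x * a) * (x * a) := by ring
  rw [semifieldSkew_apply, mul_add, mul_add, subTrace_add, subTrace_add, Finset.mul_sum,
    subTrace_sum, Finset.sum_eq_zero fun i _ => h1 i, e1, e2, subTrace_subTrace_mul, subTrace_sq,
    add_zero, ← sq, CharTwo.add_self_eq_zero]

/-- This depends on z = ax alone, which reduces the spread property to injectivity of one function
of z. -/
theorem mul_nearFlagOp_apply (a x : F) : x * nearFlagOp K c a x =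
    (a * x) ^ 2 + ∑ i, c i * ((a * x) ^ 2 + subTrace (K i) (a * x) * (a * x)) := by
  rw [nearFlagOp_apply]
  simp only [mul_add, Finset.mul_sum, Finset.sum_add_distrib, add_mul, one_mul, Finset.sum_mul]
  rw [← add_assoc]
  congr 1
  · congr 1
    · ring
    · exact Finset.sum_congr rfl fun i _ => by ring
  · exact Finset.sum_congr rfl fun i _ => by ring

theorem subTrace_mul_sq_add [CharP F 2] [Finite F] {K : IntermediateField (ZMod 2) F}
    {r : F} (hr : r ∈ K) (z : F) : subTrace K (r * (z ^ 2 + subTrace K z * z)) = 0 := by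
  rw [subTrace_mul_of_mem hr, subTrace_add, subTrace_sq, subTrace_subTrace_mul, ← sq,
    CharTwo.add_self_eq_zero, mul_zero]

theorem isSkew_nearFlagSkew [CharP F 2] [Finite F]
    (h : Odd (Module.finrank (ZMod 2) F)) (hc : ∀ i, c i ∈ K i) (a : F) :
    IsSkew (Algebra.traceForm (ZMod 2) F) (nearFlagSkew K c a) := by
  rw [isSkew_traceForm_iff]
  intro x
  have h1 : ∀ i, subTrace (ZMod 2)
      (c i * ((a * x) ^ 2 + subTrace (K i) (a * x) * (a * x))) = 0 := fun i => by
    rw [← subTrace_zmod_subTrace (K i) h, subTrace_mul_sq_add (hc i), subTrace_zero]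
  have e2 : x * (subTrace (ZMod 2) (a * x) * a) = subTrace (ZMod 2) (a * x) * (a * x) := by ring
  rw [nearFlagSkew, LinearMap.add_apply, rankOne_traceForm_apply, mul_add, mul_nearFlagOp_apply,
    mul_comm x a, e2, subTrace_add, subTrace_add, subTrace_sum,
    Finset.sum_eq_zero fun i _ => h1 i, subTrace_subTrace_mul, subTrace_sq, add_zero, ← sq,
    CharTwo.add_self_eq_zero]

/-- Summands with i ≥ k already have trace zero to K_i, hence to K_k; for i < k the coefficients lie
in K_k and come out of the trace. -/
theorem subTrace_nearFlag [CharP F 2] [Finite F]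
    (h : Odd (Module.finrank (ZMod 2) F)) (hK : StrictMono K) (hc : ∀ i, c i ∈ K i)
    (k : Fin m) (z : F) :
    subTrace (K k) (z ^ 2 + ∑ i, c i * (z ^ 2 + subTrace (K i) z * z)) =
      (1 + ∑ i ∈ Finset.Iio k, c i) * subTrace (K k) z ^ 2 +
        (∑ i ∈ Finset.Iio k, c i * subTrace (K i) z) * subTrace (K k) z := by
  rw [subTrace_add, subTrace_sum, subTrace_sq, add_mul, one_mul, add_assoc]
  congr 1
  rw [Finset.sum_mul, Finset.sum_mul, ← Finset.sum_add_distrib]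
  symm
  refine Finset.sum_subset_zero_on_sdiff (Finset.subset_univ _) (fun i hi => ?_) fun i hi => ?_
  · have hki : K k ≤ K i := hK.monotone (by simpa using hi)
    rw [← subTrace_subTrace_of_le h hki, subTrace_mul_sq_add (hc i), subTrace_zero]
  · have hik : K i ≤ K k := hK.monotone (Finset.mem_Iio.mp hi).le
    rw [subTrace_mul_of_mem (hik (hc i)), subTrace_add, subTrace_sq,
      subTrace_mul_of_mem (hik (subTrace_mem _ _))]
    ring

theorem subTrace_eq_of_nearFlag_eq [CharP F 2] [Finite F]
    (h : Odd (Module.finrank (ZMod 2) F)) (hK : StrictMono K) (hc : ∀ i, c i ∈ K i)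
    (hsum : ∀ j, ∑ i ∈ Finset.Iic j, c i ≠ 1) {z w : F}
    (hzw : z ^ 2 + ∑ i, c i * (z ^ 2 + subTrace (K i) z * z) =
      w ^ 2 + ∑ i, c i * (w ^ 2 + subTrace (K i) w * w)) (k : Fin m) :
    subTrace (K k) z = subTrace (K k) w := by
  induction k using WellFoundedLT.induction with
  | _ k ih =>
  have hk := congrArg (subTrace (K k)) hzw
  rw [subTrace_nearFlag K c h hK hc, subTrace_nearFlag K c h hK hc,
    Finset.sum_congr rfl fun i hi => congrArg (c i * ·) (ih i (Finset.mem_Iio.mp hi))] at hk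
  have hd : (1 + ∑ i ∈ Finset.Iio k, c i) * (subTrace (K k) (z + w)) ^ 2 =
      (∑ i ∈ Finset.Iio k, c i * subTrace (K i) w) * subTrace (K k) (z + w) := by
    rw [subTrace_add, CharTwo.add_sq]
    clear * - hk
    have h2 : (2 : F) = 0 := CharTwo.two_eq_zero
    grind
  suffices h0 : subTrace (K k) (z + w) = 0 by
    rwa [subTrace_add, CharTwo.add_eq_zero] at h0
  by_cases hk0 : (k : ℕ) = 0
  · have he : Finset.Iio k = ∅ := by
      ext i
      simp [Fin.lt_def, hk0]
    simpa [he] using hd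
  -- The coefficients of `hd` lie in the preceding field K_j, where the induction hypothesis kills
  -- the trace of z + w; the partial sum up to j differs from 1, so the leading coefficient is
  -- nonzero.
  let j : Fin m := ⟨k - 1, by omega⟩
  have hjk : j < k := Fin.lt_def.mpr (by simp only [j]; omega)
  have he : Finset.Iio k = Finset.Iic j := by
    ext i
    simp only [Finset.mem_Iio, Finset.mem_Iic, Fin.lt_def, Fin.le_def, j]
    omega
  rw [he] at hd
  have hmem : ∀ i ∈ Finset.Iic j, c i ∈ K j := fun i hi =>
    hK.monotone (Finset.mem_Iic.mp hi) (hc i)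
  refine eq_zero_of_mul_sq_eq_mul h (K := K j) (add_mem (one_mem _) (sum_mem hmem))
    (fun h0 => hsum j ?_) (sum_mem fun i hi => mul_mem (hmem i hi) ?_) ?_ hd
  · exact (CharTwo.add_eq_zero.mp h0).symm
  · exact hK.monotone (Finset.mem_Iic.mp hi) (subTrace_mem _ _)
  · rw [subTrace_subTrace_of_le h (hK.monotone hjk.le), subTrace_add, ih j hjk,
      CharTwo.add_self_eq_zero]

/-- The nearly flag-transitive operators form a spread-set. -/
theorem nearFlagOp_injective [CharP F 2] [Finite F] (h : Odd (Module.finrank (ZMod 2) F))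
    (hm : 0 < m) (hK : StrictMono K) (hc : ∀ i, c i ∈ K i)
    (hsum : ∀ j, ∑ i ∈ Finset.Iic j, c i ≠ 1) {x : F} (hx : x ≠ 0) :
    Function.Injective fun a => nearFlagOp K c a x := by
  intro a b hab
  have hzw := congrArg (x * ·) hab
  simp only [mul_nearFlagOp_apply] at hzw
  have htr := subTrace_eq_of_nearFlag_eq K c h hK hc hsum hzw
  let j : Fin m := ⟨m - 1, by omega⟩
  have hj : ∀ i, i ≤ j := fun i => Fin.le_def.mpr (by simp only [j]; omega)
  have hjuniv : Finset.Iic j = Finset.univ := by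
    ext i
    simp [hj i]
  have hmem : ∀ i, c i ∈ K j := fun i => hK.monotone (hj i) (hc i)
  have hd : (1 + ∑ i, c i) * (a * x + b * x) ^ 2 =
      (∑ i, c i * subTrace (K i) (b * x)) * (a * x + b * x) := by
    simp only [htr, mul_add, Finset.sum_add_distrib, ← mul_assoc, ← Finset.sum_mul] at hzw
    rw [CharTwo.add_sq]
    have h2 : (2 : F) = 0 := CharTwo.two_eq_zero
    grind
  have h0 := eq_zero_of_mul_sq_eq_mul h (K := K j)
    (add_mem (one_mem _) (sum_mem fun i _ => hmem i))
    (fun h0 => hsum j (by rw [hjuniv]; exact (CharTwo.add_eq_zero.mp h0).symm))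
    (sum_mem fun i _ => mul_mem (hmem i) (hK.monotone (hj i) (subTrace_mem _ _)))
    (by rw [subTrace_add, htr, CharTwo.add_self_eq_zero]) hd
  exact mul_right_cancel₀ hx (CharTwo.add_eq_zero.mp h0)

/-- This is the action of F^* that the semifield side need not have; it later forces the relabeling
to be a multiplication. -/
theorem nearFlagSkew_mul (u a x : F) :
    nearFlagSkew K c (u * a) x = u * nearFlagSkew K c a (u * x) := by
  have e1 : ∀ i, subTrace (K i) (u * a * x) = subTrace (K i) (a * (u * x)) := fun i => by
    congr 1
    ring
  have e2 : x * (u * a) = u * x * a := by ring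
  simp only [nearFlagSkew_apply, mul_add, Finset.mul_sum, e1, e2]
  congr 1
  · congr 1
    · ring
    · exact Finset.sum_congr rfl fun i _ => by ring
  · ring

/-- The shadow of the nearly flag-transitive spread-set covers the singular vectors
outside `0 ⊕ F`. -/
theorem exists_nearFlagSkew_apply_eq [CharP F 2] [Finite F]
    (h : Odd (Module.finrank (ZMod 2) F))
    (hm : 0 < m) (hK : StrictMono K) (hc : ∀ i, c i ∈ K i)
    (hsum : ∀ j, ∑ i ∈ Finset.Iic j, c i ≠ 1) {x y : F} (hx : x ≠ 0)
    (hxy : Algebra.traceForm (ZMod 2) F x y = 0) : ∃ a, nearFlagSkew K c a x = y := by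
  obtain ⟨a, ha⟩ := Finite.surjective_of_injective
    (nearFlagOp_injective K c h hm hK hc hsum hx) y
  replace ha : nearFlagOp K c a x = y := ha
  refine ⟨a, ?_⟩
  have h0 : Algebra.traceForm (ZMod 2) F x (nearFlagSkew K c a x) = 0 :=
    isSkew_nearFlagSkew K c h hc a x
  rw [nearFlagSkew, LinearMap.add_apply, ha, map_add, hxy, zero_add, rankOne_apply, map_smul,
    smul_eq_mul, mul_self_eq_zero] at h0
  rw [nearFlagSkew, LinearMap.add_apply, ha, rankOne_apply, h0, zero_smul, add_zero]

/-- Two members of the shadow whose sum vanishes on a subspace of small codimension are equal. -/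
theorem eq_of_nearFlagSkew_add_eq_zero [CharP F 2] [Finite F]
    (h : Odd (Module.finrank (ZMod 2) F))
    (hm : 0 < m) (hK : StrictMono K) (hc : ∀ i, c i ∈ K i)
    (hsum : ∀ j, ∑ i ∈ Finset.Iic j, c i ≠ 1) (hdim : 7 ≤ Module.finrank (ZMod 2) F)
    {a b p q r s : F}
    (hab : ∀ x, Algebra.traceForm (ZMod 2) F x p = 0 → Algebra.traceForm (ZMod 2) F x q = 0 →
      Algebra.traceForm (ZMod 2) F x r = 0 → Algebra.traceForm (ZMod 2) F x s = 0 →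
        nearFlagSkew K c a x = nearFlagSkew K c b x) : a = b := by
  -- Besides the four given conditions, x is made orthogonal to a and b to remove the rank-one
  -- terms: six conditions in dimension at least 7.
  obtain ⟨x, hx, hx'⟩ := exists_ne_zero_forall_apply_eq_zero
    (fun i => (Algebra.traceForm (ZMod 2) F).flip (![p, q, r, s, a, b] i)) (by omega)
  have h1 := hab x (hx' 0) (hx' 1) (hx' 2) (hx' 3)
  have ha : Algebra.traceForm (ZMod 2) F x a = 0 := hx' 4
  have hb : Algebra.traceForm (ZMod 2) F x b = 0 := hx' 5
  simp only [nearFlagSkew, LinearMap.add_apply, rankOne_apply, ha, hb, zero_smul, add_zero] at h1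
  exact nearFlagOp_injective K c h hm hK hc hsum hx h1

end Families

end Subfields

/-! ### Independence of traces, and transport of the polarization. -/

section Main

variable {F : Type*} [Field F] [Algebra (ZMod 2) F]

/-- Trace operators to a chain of proper subfields are linearly independent over `F` together
with the identity. -/
theorem eq_zero_of_sum_mul_subTrace_eq_mul [CharP F 2] [Finite F]
    (h : Odd (Module.finrank (ZMod 2) F)) {m : ℕ} {K : Fin m → IntermediateField (ZMod 2) F}
    (hK : IsSubfieldChain K) (c : Fin m → F) (e : F)
    (hsum : ∀ z, ∑ i, c i * subTrace (K i) z = e * z) (j : Fin m) : c j = 0 := by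
  -- Test on w + Tr(w), with Tr the trace to the largest subfield and w outside it: nonzero, yet
  -- killed by all the traces.
  have he : e = 0 := by
    have hm := Fin.pos j
    have hj : ∃ l : Fin m, ∀ i, i ≤ l :=
      ⟨⟨m - 1, by omega⟩, fun i => Fin.le_def.mpr (by simp only; omega)⟩
    obtain ⟨l, hl⟩ := hj
    obtain ⟨w, -, hw⟩ := SetLike.exists_of_lt (hK.lt_top l)
    have hz : w + subTrace (K l) w ≠ 0 := fun h0 => hw (by
      rw [CharTwo.add_eq_zero.mp h0]
      exact subTrace_mem _ _)
    have h1 := hsum (w + subTrace (K l) w)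
    rw [Finset.sum_eq_zero fun i _ => by
      rw [subTrace_add, subTrace_subTrace_of_le h (hK.strictMono.monotone (hl i)),
        CharTwo.add_self_eq_zero, mul_zero]] at h1
    exact (mul_eq_zero.mp h1.symm).resolve_right hz
  induction hj : m - (j : ℕ) using Nat.strong_induction_on generalizing j with
  | _ N ih =>
  have hgt : ∀ i, j < i → c i = 0 := fun i hi =>
    ih (m - (i : ℕ)) (by have := Fin.lt_def.mp hi; omega) i rfl
  -- Larger indices are already settled, so a z in K_j killed by the smaller traces isolates c j.
  obtain ⟨z, hzmem, hz0, hz⟩ : ∃ z ∈ K j, z ≠ 0 ∧ ∀ i < j, subTrace (K i) z = 0 := by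
    by_cases hj0 : (j : ℕ) = 0
    · exact ⟨1, one_mem _, one_ne_zero, fun i hi => by
        have := Fin.lt_def.mp hi
        omega⟩
    let l : Fin m := ⟨j - 1, by omega⟩
    have hlj : l < j := Fin.lt_def.mpr (by simp only [l]; omega)
    obtain ⟨w, hwj, hwl⟩ := SetLike.exists_of_lt (hK.strictMono hlj)
    refine ⟨w + subTrace (K l) w,
      add_mem hwj (hK.strictMono.monotone hlj.le (subTrace_mem _ _)), fun h0 => hwl ?_,
      fun i hi => ?_⟩
    · rw [CharTwo.add_eq_zero.mp h0]
      exact subTrace_mem _ _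
    · have hil : i ≤ l := by
        have := Fin.lt_def.mp hi
        exact Fin.le_def.mpr (by simp only [l]; omega)
      rw [subTrace_add, subTrace_subTrace_of_le h (hK.strictMono.monotone hil),
        CharTwo.add_self_eq_zero]
  have h1 := hsum z
  rw [he, zero_mul, Finset.sum_eq_single j (fun i _ hij => ?_) (by simp),
    subTrace_of_mem h hzmem] at h1
  · exact (mul_eq_zero.mp h1).resolve_right hz0
  · rcases lt_or_gt_of_ne hij with hlt | hgt'
    · rw [hz i hlt, mul_zero]
    · rw [hgt i hgt', zero_mul]

theorem three_le_finrank_of_bot_lt (h : Odd (Module.finrank (ZMod 2) F)) [Finite F]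
    {K : IntermediateField (ZMod 2) F} (hK : ⊥ < K) : 3 ≤ Module.finrank (ZMod 2) K := by
  obtain ⟨j, hj⟩ := odd_finrank_left K h
  have h1 : Module.finrank (ZMod 2) K ≠ 1 := fun h1 =>
    hK.ne' (IntermediateField.finrank_eq_one_iff.mp h1)
  omega

theorem seven_le_finrank (h : Odd (Module.finrank (ZMod 2) F)) [Finite F]
    {K : IntermediateField (ZMod 2) F} (hK : ⊥ < K) (hK' : K < ⊤) :
    7 ≤ Module.finrank (ZMod 2) F := by
  have h1 := three_le_finrank_of_bot_lt h hK
  obtain ⟨j, hj⟩ := odd_finrank_right K h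
  have h2 : Module.finrank K F ≠ 1 := fun h2 =>
    hK'.ne (IntermediateField.finrank_eq_one_iff_eq_top.mp h2)
  rw [← Module.finrank_mul_finrank (ZMod 2) K F]
  have h4 : 3 ≤ Module.finrank K F := by omega
  calc 7 ≤ 3 * 3 := by norm_num
    _ ≤ _ := Nat.mul_le_mul h1 h4

/-- If the shadow of the nearly flag-transitive spread-set is a quadratic function of the label with
polarization `E_{sa,sb} + E_{sb,sa}`, then all its parameters vanish. -/
theorem eq_zero_of_nearFlagSkew_add [CharP F 2] [Finite F]
    (h : Odd (Module.finrank (ZMod 2) F)) {m : ℕ} {K : Fin m → IntermediateField (ZMod 2) F}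
    (hK : IsSubfieldChain K) (c : Fin m → F) (s : F)
    (hs : ∀ a b, nearFlagSkew K c a + nearFlagSkew K c b + nearFlagSkew K c (a + b) =
      rankOne (Algebra.traceForm (ZMod 2) F) (s * a) (s * b) +
        rankOne (Algebra.traceForm (ZMod 2) F) (s * b) (s * a)) (j : Fin m) : c j = 0 := by
  -- This is `hs` with labels z and 1, evaluated at the vector 1.
  have key : ∀ z, ∑ i, c i * subTrace (K i) z =
      (∑ i, c i * subTrace (K i) 1 + subTrace (ZMod 2) (1 : F) + s * subTrace (ZMod 2) s) * z +
        (subTrace (ZMod 2) z + s * subTrace (ZMod 2) (s * z)) := fun z => by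
    have h1 := LinearMap.congr_fun (hs z 1) 1
    have h2 : (2 : F) = 0 := CharTwo.two_eq_zero
    simp only [LinearMap.add_apply, nearFlagSkew_apply, rankOne_traceForm_apply, mul_one, one_mul,
      add_mul, mul_add, subTrace_add, Finset.sum_add_distrib, CharTwo.add_sq, one_pow,
      ← mul_assoc, ← Finset.sum_mul] at h1 ⊢
    clear * - h1 h2
    generalize subTrace (ZMod 2) (1 : F) = t1 at *
    generalize subTrace (ZMod 2) z = t2 at *
    generalize subTrace (ZMod 2) s = t3 at *
    generalize subTrace (ZMod 2) (s * z) = t4 at *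
    generalize ∑ i, c i * subTrace (K i) z = t5 at *
    generalize ∑ i, c i * subTrace (K i) 1 = t6 at *
    generalize ∑ i, c i = t7 at *
    grind
  obtain ⟨e, hG⟩ : ∃ e, ∀ z, ∑ i, c i * subTrace (K i) z =
      e * z + (subTrace (ZMod 2) z + s * subTrace (ZMod 2) (s * z)) := ⟨_, key⟩
  clear key
  refine eq_zero_of_sum_mul_subTrace_eq_mul h hK c e (fun z => ?_) j
  let k : Fin m := ⟨0, Fin.pos j⟩
  have hk : ∀ i, K k ≤ K i := fun i => hK.strictMono.monotone (Fin.le_def.mpr (Nat.zero_le _))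
  -- Replacing z by rz with r in the smallest subfield scales the trace sum and e z by r. Two
  -- conditions on r, in dimension at least 3, kill both absolute-trace terms.
  obtain ⟨r, hr0, hr⟩ := exists_ne_zero_forall_apply_eq_zero (U := K k)
    ![(Algebra.traceForm (ZMod 2) F z).comp (K k).val.toLinearMap,
      (Algebra.traceForm (ZMod 2) F (s * z)).comp (K k).val.toLinearMap]
    (three_le_finrank_of_bot_lt h (hK.bot_lt k))
  have hr1 : subTrace (ZMod 2) ((r : F) * z) = 0 :=
    subTrace_zmod_eq_zero_iff.mpr (by rw [mul_comm]; exact hr 0)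
  have hr2 : subTrace (ZMod 2) (s * ((r : F) * z)) = 0 :=
    subTrace_zmod_eq_zero_iff.mpr (by
      rw [show s * ((r : F) * z) = s * z * r by ring]
      exact hr 1)
  have h1 := hG (r * z)
  rw [hr1, hr2, mul_zero, add_zero, add_zero, Finset.sum_congr rfl fun i _ =>
    congrArg (c i * ·) (subTrace_mul_of_mem (hk i r.2) z)] at h1
  have hr0' : (r : F) ≠ 0 := fun h0 => hr0 (Subtype.ext h0)
  apply mul_left_cancel₀ hr0'
  rw [Finset.mul_sum, ← mul_left_comm, ← h1]
  exact Finset.sum_congr rfl fun i _ => mul_left_comm _ _ _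

/-- An isomorphism between the two dual hyperovals induces a bijection `s` of the labels such
that sums of members of the shadow of the nearly flag-transitive spread-set have rank two. -/
theorem exists_bijective_of_isomorphic [CharP F 2] [Finite F]
    (h : Odd (Module.finrank (ZMod 2) F)) (hdim : 7 ≤ Module.finrank (ZMod 2) F)
    {m : ℕ} (K : Fin m → IntermediateField (ZMod 2) F) (c : Fin m → F)
    {m' : ℕ} (hm' : 0 < m') (K' : Fin m' → IntermediateField (ZMod 2) F) (c' : Fin m' → F)
    (hK' : StrictMono K') (hc' : ∀ i, c' i ∈ K' i) (hsum : ∀ j, ∑ i ∈ Finset.Iic j, c' i ≠ 1)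
    (hiso : Isomorphic (semifieldDHO K c) (nearFlagDHO K' c')) :
    ∃ s : F → F, Function.Bijective s ∧ s 0 = 0 ∧ ∀ a b d, s d = s a + s b →
      nearFlagSkew K' c' a + nearFlagSkew K' c' b + nearFlagSkew K' c' d =
        rankOne (Algebra.traceForm (ZMod 2) F) (s a) (s b) +
          rankOne (Algebra.traceForm (ZMod 2) F) (s b) (s a) := by
  have hskew := isSkew_semifieldSkew K c h
  have hskew' := isSkew_nearFlagSkew K' c' h hc'
  rw [semifieldDHO, nearFlagDHO,
    shadow_range _ (fun x => traceForm_separating_right x) _ hskew,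
    shadow_range _ (fun x => traceForm_separating_right x) _ hskew'] at hiso
  obtain ⟨α, δ, M, hα, hδ, hαδ, hB⟩ := hiso.exists_triangular (by omega) _ traceForm_separating
    (by rintro _ ⟨a, rfl⟩; exact hskew a)
    (fun x y hx hxy => by
      obtain ⟨a, ha⟩ := exists_nearFlagSkew_apply_eq K' c' h hm' hK' hc' hsum hx hxy
      exact ⟨_, ⟨a, rfl⟩, ha⟩)
  have hρ : ∀ a', ∃ a, ∀ x, nearFlagSkew K' c' a' (α x) = M x + δ (semifieldSkew K c a x) :=
    fun a' => by
      obtain ⟨_, ⟨a, rfl⟩, ha⟩ := hB _ ⟨a', rfl⟩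
      exact ⟨a, ha⟩
  choose ρ hρ using hρ
  have hρinj : Function.Injective ρ := fun a b hab => by
    refine eq_of_nearFlagSkew_add_eq_zero K' c' h hm' hK' hc' hsum hdim
      (p := 0) (q := 0) (r := 0) (s := 0) fun x _ _ _ _ => ?_
    obtain ⟨x, rfl⟩ := hα x
    rw [hρ, hρ, hab]
  -- Adding ρ 0 normalizes s 0 = 0. Since B'_0 = 0, the operator M equals δ ∘ B_{ρ(0)}, which
  -- supplies the fourth term of the semifield identity.
  refine ⟨fun a => δ (ρ a + ρ 0), Finite.injective_iff_bijective.mp fun a b hab =>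
    hρinj (add_right_cancel (hδ hab)),
    by simp only [CharTwo.add_self_eq_zero, map_zero], fun a b d hd => ?_⟩
  have hd' : ρ d = ρ a + ρ b + ρ 0 := by
    have h1 := hδ (hd.trans (map_add δ _ _).symm)
    have h2 : (2 : F) = 0 := CharTwo.two_eq_zero
    clear * - h1 h2
    grind
  ext x
  obtain ⟨x, rfl⟩ := hα x
  have h0 : nearFlagSkew K' c' 0 (α x) = 0 := by simp [nearFlagSkew_apply]
  have h4 := congrArg δ (LinearMap.congr_fun
    (semifieldSkew_add_add_add_add K c (ρ a) (ρ b) (ρ 0)) x)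
  rw [← hd'] at h4
  rw [hρ] at h0
  simp only [LinearMap.add_apply, rankOne_apply, hρ, hαδ, map_add, map_smul] at h4 h0 ⊢
  rw [← h4, (CharTwo.add_eq_zero.mp h0)]
  have h2 : (2 : F) = 0 := CharTwo.two_eq_zero
  clear * - h2
  grind

end Main

/-! ### Equivariance of the relabeling under F^*. -/

section Rigidity

variable {F : Type*} [Field F] [Algebra (ZMod 2) F]

/-- The cyclic group `F^*` acts on the shadow of the nearly flag-transitive spread-set,
and the bijection `s` is equivariant, hence a multiplication. -/
theorem eq_mul_of_nearFlagSkew_add [CharP F 2] [Finite F]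
    (h : Odd (Module.finrank (ZMod 2) F)) (hdim : 7 ≤ Module.finrank (ZMod 2) F)
    {m : ℕ} (hm : 0 < m) (K : Fin m → IntermediateField (ZMod 2) F) (c : Fin m → F)
    (hK : StrictMono K) (hc : ∀ i, c i ∈ K i) (hsum : ∀ j, ∑ i ∈ Finset.Iic j, c i ≠ 1)
    {s : F → F} (hbij : Function.Bijective s) (hs0 : s 0 = 0)
    (hs : ∀ a b d, s d = s a + s b →
      nearFlagSkew K c a + nearFlagSkew K c b + nearFlagSkew K c d =
        rankOne (Algebra.traceForm (ZMod 2) F) (s a) (s b) +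
          rankOne (Algebra.traceForm (ZMod 2) F) (s b) (s a)) (u : F) : s u = s 1 * u := by
  by_cases hu : u = 0
  · rw [hu, hs0, mul_zero]
  have hmul : ∀ a b d, s d = s a + s b →
      nearFlagSkew K c (u * a) + nearFlagSkew K c (u * b) + nearFlagSkew K c (u * d) =
        rankOne (Algebra.traceForm (ZMod 2) F) (u * s a) (u * s b) +
          rankOne (Algebra.traceForm (ZMod 2) F) (u * s b) (u * s a) := fun a b d hd => by
    ext x
    have h1 := congrArg (u * ·) (LinearMap.congr_fun (hs a b d hd) (u * x))
    have e : ∀ y, u * x * y = x * (u * y) := fun y => by ring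
    simp only [LinearMap.add_apply, rankOne_traceForm_apply, nearFlagSkew_mul, mul_add,
      e] at h1 ⊢
    rw [h1]
    ring
  have hpair : ∀ a b,
      rankOne (Algebra.traceForm (ZMod 2) F) (u * s a) (u * s b) +
          rankOne (Algebra.traceForm (ZMod 2) F) (u * s b) (u * s a) =
        rankOne (Algebra.traceForm (ZMod 2) F) (s (u * a)) (s (u * b)) +
          rankOne (Algebra.traceForm (ZMod 2) F) (s (u * b)) (s (u * a)) := fun a b => by
    obtain ⟨d, hd⟩ := hbij.2 (s a + s b)
    obtain ⟨d', hd'⟩ := hbij.2 (s (u * a) + s (u * b))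
    have h1 := hmul a b d hd
    have h2 := hs _ _ _ hd'
    -- Both sums have rank at most two, so B'_{ud} and B'_{d'} agree on a subspace of codimension at
    -- most 4, which determines the label.
    have h3 : u * d = d' :=
      eq_of_nearFlagSkew_add_eq_zero K c h hm hK hc hsum hdim (p := u * s a) (q := u * s b)
          (r := s (u * a)) (s := s (u * b)) fun x hp hq hr hs => by
        have e1 := LinearMap.congr_fun h1 x
        have e2 := LinearMap.congr_fun h2 x
        simp only [LinearMap.add_apply, rankOne_apply, hp, hq, hr, hs, zero_smul] at e1 e2
        exact add_left_cancel (e1.trans e2.symm)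
    rw [← h1, ← h2, h3]
  obtain ⟨t, ht⟩ := hbij.2.hasRightInverse
  have hts : ∀ a, t (s a) = a := fun a => hbij.1 (ht _)
  -- By `hpair`, conjugating multiplication by u through s and then undoing multiplication by u
  -- preserves all E_{p,q} + E_{q,p}; evaluating the resulting identity at u * s 1 gives s u = s 1 *
  -- u.
  have key := eq_self_of_rankOne_add_rankOne (by omega) (Algebra.traceForm (ZMod 2) F)
    (fun x => traceForm_separating_right x) (fun p => s (u * t (u⁻¹ * p)))
    (fun y => ⟨u * s (u⁻¹ * t y), by
      simp only [inv_mul_cancel_left₀ hu, mul_inv_cancel_left₀ hu, hts, ht y]⟩)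
    (fun p q => by
      have := hpair (t (u⁻¹ * p)) (t (u⁻¹ * q))
      rwa [ht, ht, mul_inv_cancel_left₀ hu, mul_inv_cancel_left₀ hu] at this) (u * s 1)
  simp only [inv_mul_cancel_left₀ hu, hts, mul_one] at key
  rw [key, mul_comm]

end Rigidity

end DualHyperoval

theorem mainTheorem7 (n : ℕ) (hn : 1 < n) (hodd : Odd n)
    (F : Type*) [Field F] [Algebra (ZMod 2) F] (hF : Nat.card F = 2 ^ n)
    -- data of a semifield spread-set
    (m : ℕ) (K : Fin m → IntermediateField (ZMod 2) F) (hK : DualHyperoval.IsSubfieldChain K)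
    (c : Fin m → F) (hc : ∀ i, c i ≠ 0)
    -- data of a nearly flag-transitive spread-set
    (m' : ℕ) (K' : Fin m' → IntermediateField (ZMod 2) F) (hK' : DualHyperoval.IsSubfieldChain K')
    (c' : Fin m' → F) (hc'mem : ∀ j, c' j ∈ K' j) (hc'sum : ∀ j, ∑ i ∈ Finset.Iic j, c' i ≠ 1)
    (hc'ne : ∃ j, c' j ≠ 0) :
    ¬ DualHyperoval.Isomorphic (DualHyperoval.semifieldDHO K c)
        (DualHyperoval.nearFlagDHO K' c') := by
  intro hiso
  obtain ⟨j, hj⟩ := hc'ne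
  have hchar : CharP F 2 := DualHyperoval.charP_two_of_algebra
  have hfin : Finite F := Nat.finite_of_card_ne_zero (by rw [hF]; positivity)
  have h : Odd (Module.finrank (ZMod 2) F) := by
    have h1 := Module.natCard_eq_pow_finrank (K := ZMod 2) (V := F)
    rw [hF, Nat.card_zmod] at h1
    rwa [← Nat.pow_right_injective le_rfl h1]
  have hdim := DualHyperoval.seven_le_finrank h (hK'.bot_lt j) (hK'.lt_top j)
  have hm' : 0 < m' := Fin.pos j
  obtain ⟨s, hbij, hs0, hs⟩ := DualHyperoval.exists_bijective_of_isomorphic h hdim K c hm' K' c'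
    hK'.strictMono hc'mem hc'sum hiso
  have hmul := DualHyperoval.eq_mul_of_nearFlagSkew_add h hdim hm' K' c' hK'.strictMono hc'mem
    hc'sum hbij hs0 hs
  refine hj (DualHyperoval.eq_zero_of_nearFlagSkew_add h hK' c' (s 1) (fun a b => ?_) j)
  have := hs a b (a + b) (by rw [hmul, hmul a, hmul b, mul_add])
  rwa [hmul a, hmul b] at this
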